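/- Let $M=(E,\mathcal I)$ be a loopless matroid on a finite set $E$ with rank function $r$, and let $c=(c_1,\dots,c_m)$ be a sequence of integers with $m\ge 2$ and $0\le c_1<c_2<\dots<c_m\le r(E)$. For such a sequence (also of length one) let $P^{c}_{\mathcal I}(E)\subseteq\mathbb R^E$ be the convex hull of the incidence vectors $\chi^I$ of all $I\in\mathcal I$ with $|I|=c_q$ for some $q$; thus $P^{(k)}_{\mathcal I}(E)$ is the convex hull of the incidence vectors of the independent sets of cardinality $k$. For $x\in\mathbb R^E$ and $A\subseteq E$ put $x(A)=\sum_{e\in A}x_e$. A linear inequality that is valid for a polytope $P$ defines a facet of $P$ if the set of points of $P$ that satisfy it with equality is a nonempty face of dimension $\dim P-1$. A set $F\subseteq E$ is closed if $r(F)<r(F\cup\{e\})$ for all $e\in E\setminus F$. For $k\in\mathbb N$ and $A\subseteq E$ put $r^k(A)=k-r(E\setminus A)$; $A$ is $k$-separable if there is a partition $A=A_1\,\dot\cup\,A_2$ with $A_1\ne\emptyset\ne A_2$ and $r^k(A_1)+r^k(A_2)=r^k(A)$, and $k$-inseparable otherwise. Let $F\subseteq E$ with $c_p<r(F)<c_{p+1}$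 for some $p\in\{1,\dots,m-1\}$. Then the rank induced forbidden set inequality $$\mathrm{FS}_F(x):=(c_{p+1}-r(F))\,x(F)-(r(F)-c_p)\,x(E\setminus F)\ \le\ c_p\,(c_{p+1}-r(F))$$ defines a facet of $P^{c}_{\mathcal I}(E)$ if and only if one of the following conditions holds: (a) $c_p=c_1=0$ and the inequality $x(F)\le r(F)$ defines a facet of $P^{(c_{p+1})}_{\mathcal I}(E)$; (b) $c_p>0$, $F$ is closed, and (i) $E\setminus F$ is $c_{p+1}$-inseparable or (ii) $c_{p+1}<r(E)$. -/

import Mathlib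

namespace CardMatroid

variable {E : Type*} [Fintype E] [DecidableEq E]

/-- The rank `r(F)` of a set `F` in a matroid on a finite set, as a natural number. -/
noncomputable def rank (M : Matroid E) (F : Finset E) : ℕ :=
  (M.eRk (F : Set E)).toNat

/-- The incidence vector `χ^I ∈ ℝ^E`. -/
def incidence (I : Finset E) : E → ℝ :=
  fun e => if e ∈ I then 1 else 0

/-- The cardinality constrained matroid polytope `P^c(E)`: the convex hull of the incidence vectors
of the independent sets whose cardinality is a member of `c = (c_1, …, c_m)`. -/
def cardPolytope (M : Matroid E) {m : ℕ} (c : Fin m → ℕ) : Set (E → ℝ) :=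
  convexHull ℝ {x | ∃ I : Finset E, M.Indep (I : Set E) ∧ (∃ i, I.card = c i) ∧ x = incidence I}

/-- The linear form `x ↦ x(F) = ∑_{e ∈ F} x_e`. -/
def setSum (F : Finset E) : (E → ℝ) →ₗ[ℝ] ℝ :=
  ∑ e ∈ F, LinearMap.proj e

/-- The left-hand side
`FS_F(x) = (c_{p+1} - r(F)) x(F) - (r(F) - c_p) x(E ∖ F)` of the rank induced forbidden set
inequality, with `lo = c_p` and `hi = c_{p+1}`. -/
noncomputable def forbiddenSetForm (M : Matroid E) (lo hi : ℕ) (F : Finset E) :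
    (E → ℝ) →ₗ[ℝ] ℝ :=
  ((hi : ℝ) - (rank M F : ℝ)) • setSum F - ((rank M F : ℝ) - (lo : ℝ)) • setSum Fᶜ

/-- The dimension of (the affine hull of) a nonempty set. -/
noncomputable def affDim (S : Set (E → ℝ)) : ℕ :=
  Module.finrank ℝ (vectorSpan ℝ S)

/-- The linear inequality `a x ≤ b` defines a facet of `P`: it is valid for `P`, and the induced
face is nonempty and has dimension `dim P - 1`. -/
def DefinesFacet (P : Set (E → ℝ)) (a : (E → ℝ) →ₗ[ℝ] ℝ) (b : ℝ) : Prop :=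
  (∀ x ∈ P, a x ≤ b) ∧
    {x ∈ P | a x = b}.Nonempty ∧ affDim {x ∈ P | a x = b} + 1 = affDim P

/-- The `k`-rank `r^k(F) = k - r(E ∖ F)`. -/
noncomputable def kRank (M : Matroid E) (k : ℕ) (F : Finset E) : ℤ :=
  (k : ℤ) - (rank M Fᶜ : ℤ)

/-- `F` is `k`-separable if it has a partition into two nonempty sets on which the `k`-rank is
additive. -/
def KSeparable (M : Matroid E) (k : ℕ) (F : Finset E) : Prop :=
  ∃ F₁ F₂ : Finset E, F₁.Nonempty ∧ F₂.Nonempty ∧ Disjoint F₁ F₂ ∧ F₁ ∪ F₂ = F ∧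
    kRank M k F₁ + kRank M k F₂ = kRank M k F

/-- `F` is `k`-inseparable. -/
def KInseparable (M : Matroid E) (k : ℕ) (F : Finset E) : Prop :=
  ¬ KSeparable M k F

end CardMatroid

set_option linter.unusedSectionVars false

namespace CardMatroid

variable {E : Type*} [Fintype E] [DecidableEq E]

/-! ### Dimension of faces of convex hulls -/

/-! The face is the hull of the incidence vectors of the tight sets: independent subsets of `F` of
size $c_p$, and independent sets of size $c_{p+1}$ that meet `F` in a basis of `F`. Dimensions are
computed dually: $\dim S$ plus the dimension of the space of forms constant on $S$ is $|E|$. When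
the polytope is full-dimensional, the inequality thus defines a facet iff every form constant on the
tight sets is a multiple of $\mathrm{FS}_F$.

Let $c_p>0$; the polytope is then full-dimensional. If `F` is not closed, an element of its closure
outside `F` lies in no tight set, so its coordinate is a further constant form. If $c_{p+1}=r(E)$
and $E\setminus F$ separates, tight bases meet both parts in fixed numbers, which gives another such
form (`exists_form_of_kSeparable`). Conversely, view a form constant on the tight sets as a weight
on $E$. The small tight sets make it constant on `F` (`weight_eq_of_sum_eq` in the restriction to
`F`). Off `F` it is constant by the same lemma in the contraction by `F` if $c_{p+1}<r(E)$
(`weight_eq_of_isFlat`), and by base exchange and inseparability if $c_{p+1}=r(E)$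
(`weight_eq_of_kInseparable`). Comparing the two kinds of tight set fixes the ratio of the two
constants.

Let $c_p=0$. The only small tight set is empty, so the face is a cone from the origin over the face
$x(F)=r(F)$ of $P^{(c_{p+1})}$. The dimensions of this face and of $P^{(c_{p+1})}$ both rise by one,
which is (a). -/

theorem apply_incidence (φ : Module.Dual ℝ (E → ℝ)) (I : Finset E) :
    φ (incidence I) = ∑ e ∈ I, φ (Pi.single e 1) := by
  have : incidence I = ∑ e ∈ I, Pi.single e (1 : ℝ) := by
    ext x
    simp [incidence, Finset.sum_apply, Pi.single_apply]
  rw [this, map_sum]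

theorem setSum_apply (F : Finset E) (x : E → ℝ) : setSum F x = ∑ e ∈ F, x e := by
  simp [setSum]

theorem setSum_incidence (F I : Finset E) : setSum F (incidence I) = ((I ∩ F).card : ℝ) := by
  simp [setSum_apply, incidence, Finset.inter_comm]

theorem setSum_single (F : Finset E) (e : E) :
    setSum F (Pi.single e 1) = if e ∈ F then 1 else 0 := by
  simp [setSum_apply, Pi.single_apply]

theorem dual_ext {φ ψ : Module.Dual ℝ (E → ℝ)}
    (h : ∀ e, φ (Pi.single e 1) = ψ (Pi.single e 1)) : φ = ψ :=
  (Pi.basisFun ℝ E).ext fun e => by simpa using h e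

theorem mem_dualAnnihilator_vectorSpan {S : Set (E → ℝ)} {φ : Module.Dual ℝ (E → ℝ)} :
    φ ∈ (vectorSpan ℝ S).dualAnnihilator ↔ ∀ x ∈ S, ∀ y ∈ S, φ x = φ y := by
  rw [vectorSpan_def, Submodule.mem_dualAnnihilator]
  constructor
  · intro h x hx y hy
    have := h _ (Submodule.subset_span (Set.vsub_mem_vsub hx hy))
    rwa [vsub_eq_sub, map_sub, sub_eq_zero] at this
  · intro h w hw
    have : Submodule.span ℝ (S -ᵥ S) ≤ LinearMap.ker φ := by
      rw [Submodule.span_le]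
      rintro _ ⟨x, hx, y, hy, rfl⟩
      simp [h x hx y hy]
    exact this hw

theorem affDim_add_finrank_dualAnnihilator (S : Set (E → ℝ)) :
    affDim S + Module.finrank ℝ (vectorSpan ℝ S).dualAnnihilator = Fintype.card E := by
  rw [affDim, Subspace.finrank_add_finrank_dualAnnihilator_eq, Module.finrank_fintype_fun_eq_card]

theorem affDim_eq_card {S : Set (E → ℝ)}
    (h : ∀ φ : Module.Dual ℝ (E → ℝ), (∀ x ∈ S, ∀ y ∈ S, φ x = φ y) → φ = 0) :
    affDim S = Fintype.card E := by
  have h0 : (vectorSpan ℝ S).dualAnnihilator = ⊥ :=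
    (Submodule.eq_bot_iff _).2 fun φ hφ => h φ (mem_dualAnnihilator_vectorSpan.1 hφ)
  rw [← affDim_add_finrank_dualAnnihilator S, h0, finrank_bot, add_zero]

/-- The annihilator of the direction space contains `a ≠ 0`, so codimension one means that `a` spans
it. -/
theorem affDim_add_one_eq_card_iff {S : Set (E → ℝ)} {a : Module.Dual ℝ (E → ℝ)} {b : ℝ}
    (ha : a ≠ 0) (haS : ∀ x ∈ S, a x = b) :
    affDim S + 1 = Fintype.card E ↔
      ∀ φ : Module.Dual ℝ (E → ℝ), (∀ x ∈ S, ∀ y ∈ S, φ x = φ y) → ∃ t : ℝ, t • a = φ := by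
  have hmem : a ∈ (vectorSpan ℝ S).dualAnnihilator :=
    mem_dualAnnihilator_vectorSpan.2 fun x hx y hy => (haS x hx).trans (haS y hy).symm
  have hne : (⟨a, hmem⟩ : (vectorSpan ℝ S).dualAnnihilator) ≠ 0 := by simpa using ha
  rw [← affDim_add_finrank_dualAnnihilator S, add_right_inj, eq_comm]
  refine (finrank_eq_one_iff_of_nonzero' (V := (vectorSpan ℝ S).dualAnnihilator)
    ⟨a, hmem⟩ hne).trans ?_
  simp only [Subtype.forall, Subtype.ext_iff, mem_dualAnnihilator_vectorSpan]
  rfl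

theorem affDim_convexHull (V : Set (E → ℝ)) : affDim (convexHull ℝ V) = affDim V := by
  rw [affDim, affDim, ← direction_affineSpan, affineSpan_convexHull, direction_affineSpan]

theorem face_convexHull {V : Set (E → ℝ)} {a : (E → ℝ) →ₗ[ℝ] ℝ} {b : ℝ}
    (hV : ∀ v ∈ V, a v ≤ b) :
    {x ∈ convexHull ℝ V | a x = b} = convexHull ℝ {v ∈ V | a v = b} := by
  apply Set.Subset.antisymm
  -- A proper convex combination of values at most `b` equals `b` only if both values do; hence this
  -- set is convex, and it contains `V`.
  · have hconv : Convex ℝ {x | a x ≤ b ∧ (a x = b → x ∈ convexHull ℝ {v ∈ V | a v = b})} := by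
      rw [convex_iff_forall_pos]
      rintro x ⟨hx, hx'⟩ y ⟨hy, hy'⟩ s t hs ht hst
      have hb : s * b + t * b = b := by rw [← add_mul, hst, one_mul]
      have h1 := mul_le_mul_of_nonneg_left hx hs.le
      have h2 := mul_le_mul_of_nonneg_left hy ht.le
      simp only [Set.mem_ofPred_eq, map_add, map_smul, smul_eq_mul]
      refine ⟨by linarith, fun h => ?_⟩
      exact convex_convexHull ℝ _
        (hx' (mul_left_cancel₀ hs.ne' (by linarith)))
        (hy' (mul_left_cancel₀ ht.ne' (by linarith))) hs.le ht.le hst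
    rintro x ⟨hx, hxb⟩
    have hsub : V ⊆ {x | a x ≤ b ∧ (a x = b → x ∈ convexHull ℝ {v ∈ V | a v = b})} :=
      fun v hv => ⟨hV v hv, fun h => subset_convexHull ℝ _ ⟨hv, h⟩⟩
    exact (convexHull_min hsub hconv hx).2 hxb
  · apply convexHull_min
    · exact fun v hv => ⟨subset_convexHull ℝ _ hv.1, hv.2⟩
    · exact (convex_convexHull ℝ V).inter (convex_hyperplane a.isLinear b)

theorem definesFacet_convexHull_iff {V : Set (E → ℝ)} {a : (E → ℝ) →ₗ[ℝ] ℝ} {b : ℝ}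
    (hV : ∀ v ∈ V, a v ≤ b) (hne : {v ∈ V | a v = b}.Nonempty) :
    DefinesFacet (convexHull ℝ V) a b ↔ affDim {v ∈ V | a v = b} + 1 = affDim V := by
  have hvalid : ∀ x ∈ convexHull ℝ V, a x ≤ b :=
    fun x hx => convexHull_min hV (convex_halfSpace_le a.isLinear b) hx
  rw [DefinesFacet, face_convexHull hV, affDim_convexHull, affDim_convexHull]
  exact ⟨fun h => h.2.2, fun h => ⟨hvalid, hne.convexHull, h⟩⟩

/-- Coning from the origin over a set in a hyperplane off the origin raises the dimension by one. -/
theorem affDim_insert_zero {T : Set (E → ℝ)} (hT : T.Nonempty) {a : (E → ℝ) →ₗ[ℝ] ℝ} {b : ℝ}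
    (hb : b ≠ 0) (ha : ∀ x ∈ T, a x = b) : affDim (insert 0 T) = affDim T + 1 := by
  obtain ⟨t, ht⟩ := hT
  have hker : vectorSpan ℝ T ≤ LinearMap.ker a := by
    rw [vectorSpan_def, Submodule.span_le]
    rintro _ ⟨x, hx, y, hy, rfl⟩
    simp [ha x hx, ha y hy]
  have ht0 : t ≠ 0 := fun h => hb (by rw [← ha t ht, h, map_zero])
  have hsup : vectorSpan ℝ (insert 0 T) = vectorSpan ℝ T ⊔ Submodule.span ℝ {t} := by
    apply le_antisymm
    · rw [vectorSpan_eq_span_vsub_set_right ℝ (Set.mem_insert_of_mem 0 ht), Submodule.span_le]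
      rintro _ ⟨x, hx | hx, rfl⟩
      · subst hx
        simp only [vsub_eq_sub, zero_sub, SetLike.mem_coe]
        exact Submodule.mem_sup_right (Submodule.neg_mem _ (Submodule.mem_span_singleton_self t))
      · exact Submodule.mem_sup_left (vsub_mem_vectorSpan ℝ hx ht)
    · refine sup_le (vectorSpan_mono ℝ (Set.subset_insert 0 T)) ?_
      rw [Submodule.span_singleton_le_iff_mem]
      simpa using vsub_mem_vectorSpan ℝ (Set.mem_insert_of_mem 0 ht) (Set.mem_insert 0 T)
  have hinf : vectorSpan ℝ T ⊓ Submodule.span ℝ {t} = ⊥ := by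
    rw [Submodule.eq_bot_iff]
    rintro x ⟨hx, hx'⟩
    obtain ⟨s, rfl⟩ := Submodule.mem_span_singleton.1 hx'
    have : s * b = 0 := by simpa [ha t ht] using hker hx
    simp [(mul_eq_zero.1 this).resolve_right hb]
  have := Submodule.finrank_sup_add_finrank_inf_eq (vectorSpan ℝ T) (Submodule.span ℝ {t})
  rw [hinf, finrank_bot, finrank_span_singleton ht0, ← hsup] at this
  simpa [affDim] using this

/-! ### Ranks and independent sets -/

theorem coe_rank (M : Matroid E) (F : Finset E) : (rank M F : ℕ∞) = M.eRk (F : Set E) := by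
  rw [rank, ENat.natCast_toNat]
  exact (lt_of_le_of_lt (M.eRk_le_encard _) (by simp)).ne

theorem card_le_rank {M : Matroid E} {I F : Finset E} (hI : M.Indep (I : Set E)) (hIF : I ⊆ F) :
    I.card ≤ rank M F := by
  have := hI.encard_le_eRk_of_subset (Finset.coe_subset.2 hIF)
  rw [← coe_rank, Set.encard_coe_eq_coe_finsetCard] at this
  exact_mod_cast this

theorem rank_eq_card {M : Matroid E} {I F : Finset E} (h : M.IsBasis (I : Set E) (F : Set E)) :
    rank M F = I.card := by
  have := h.eRk_eq_encard
  rw [← coe_rank, Set.encard_coe_eq_coe_finsetCard] at this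
  exact_mod_cast this

theorem exists_isBasis_superset {M : Matroid E} (hE : M.E = Set.univ) {I F : Finset E}
    (hI : M.Indep (I : Set E)) (hIF : I ⊆ F) :
    ∃ B : Finset E, I ⊆ B ∧ M.IsBasis (B : Set E) (F : Set E) := by
  obtain ⟨B, hB, hIB⟩ := hI.subset_isBasis_of_subset (Finset.coe_subset.2 hIF) (by simp [hE])
  lift B to Finset E using B.toFinite
  exact ⟨B, Finset.coe_subset.1 hIB, hB⟩

theorem isBasis_of_card_eq_rank {M : Matroid E} (hE : M.E = Set.univ) {I F : Finset E}
    (hI : M.Indep (I : Set E)) (hIF : I ⊆ F) (h : I.card = rank M F) :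
    M.IsBasis (I : Set E) (F : Set E) := by
  obtain ⟨B, hIB, hB⟩ := exists_isBasis_superset hE hI hIF
  rwa [Finset.eq_of_subset_of_card_le hIB (by rw [h, rank_eq_card hB])]

/-- An independent set can be enlarged to any cardinality attained by an independent set. -/
theorem exists_indep_superset_card_eq {N : Matroid E} {I K : Finset E} {n : ℕ}
    (hI : N.Indep (I : Set E)) (hK : N.Indep (K : Set E)) (hIn : I.card ≤ n) (hn : n ≤ K.card) :
    ∃ J : Finset E, I ⊆ J ∧ N.Indep (J : Set E) ∧ J.card = n := by
  obtain ⟨B, hB, hIB⟩ := hI.exists_isBase_superset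
  lift B to Finset E using B.toFinite
  have hBn : n ≤ B.card := by
    have := hK.encard_le_eRank
    rw [← hB.encard_eq_eRank, Set.encard_coe_eq_coe_finsetCard,
      Set.encard_coe_eq_coe_finsetCard] at this
    exact hn.trans (by exact_mod_cast this)
  obtain ⟨J, hIJ, hJB, hJ⟩ :=
    Finset.exists_subsuperset_card_eq (Finset.coe_subset.1 hIB) hIn hBn
  exact ⟨J, hIJ, hB.indep.subset (Finset.coe_subset.2 hJB), hJ⟩

/-- A weight that is constant on the independent sets of a cardinality strictly between zero and
the rank is constant on the nonloops. -/
theorem weight_eq_of_sum_eq {N : Matroid E} {k : ℕ} (hk : 0 < k) {w : E → ℝ} {γ : ℝ}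
    (hw : ∀ J : Finset E, N.Indep (J : Set E) → J.card = k → ∑ e ∈ J, w e = γ)
    {K : Finset E} (hK : N.Indep (K : Set E)) (hkK : k < K.card) {e f : E}
    (he : N.IsNonloop e) (hf : N.IsNonloop f) : w e = w f := by
  by_cases hef : e = f
  · rw [hef]
  by_cases hi : N.Indep {e, f}
  -- Deleting `e` or `f` from an independent set of size `k + 1` containing both leaves two sets of
  -- equal weight.
  · obtain ⟨J, hJ, hJi, hJc⟩ := exists_indep_superset_card_eq (I := {e, f}) (n := k + 1)
      (by simpa using hi) hK (by rw [Finset.card_pair hef]; omega) hkK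
    have heJ : e ∈ J := hJ (by simp)
    have hfJ : f ∈ J := hJ (by simp)
    have key : ∀ x ∈ J, w x + γ = ∑ y ∈ J, w y := fun x hx => by
      rw [← Finset.add_sum_erase J w hx, hw (J.erase x)
        (hJi.subset (Finset.coe_subset.2 (J.erase_subset x)))
        (by rw [Finset.card_erase_of_mem hx, hJc]; rfl)]
    linarith [key e heJ, key f hfJ]
  · obtain ⟨J, hJ, hJi, hJc⟩ := exists_indep_superset_card_eq (I := {e}) (n := k)
      (by simpa using he) hK (by rw [Finset.card_singleton]; exact hk) hkK.le
    have heJ : e ∈ J := hJ (by simp)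
    have hfJ : f ∉ J := fun hfJ => hi (hJi.subset (by
      rintro x (rfl | rfl)
      · exact heJ
      · exact hfJ))
    -- Here `e` and `f` are parallel, so `f` can replace `e` in `J`: if `f` were spanned by `J.erase
    -- e`, so would be `e`.
    have hei : e ∈ N.closure {f} := by
      rw [(Matroid.indep_singleton.2 hf).mem_closure_iff_of_notMem (by simpa using hef)]
      refine ⟨hi, ?_⟩
      rintro x (rfl | rfl)
      · exact he.mem_ground
      · exact hf.mem_ground
    have hJe : N.Indep ((J.erase e : Finset E) : Set E) :=
      hJi.subset (Finset.coe_subset.2 (J.erase_subset e))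
    have hJf : N.Indep ((insert f (J.erase e) : Finset E) : Set E) := by
      rw [Finset.coe_insert, ← hJe.notMem_closure_iff_of_notMem (by simp [hfJ]) hf.mem_ground]
      intro hmem
      have := N.closure_subset_closure_of_subset_closure (Set.singleton_subset_iff.2 hmem) hei
      rw [hJe.mem_closure_iff_of_notMem (by simp), ← Finset.coe_insert,
        Finset.insert_erase heJ] at this
      exact this.not_indep hJi
    have h1 := hw _ hJf (by
      rw [Finset.card_insert_of_notMem (by simp [hfJ]), Finset.card_erase_add_one heJ, hJc])
    rw [Finset.sum_insert (by simp [hfJ])] at h1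
    have h2 := hw J hJi hJc
    rw [← Finset.add_sum_erase J w heJ] at h2
    linarith

/-- A set `X` that is closed under the exchanges of a base `B` meets `B` in a basis. -/
theorem rank_eq_card_inter_of_exchange {M : Matroid E} {B X : Finset E}
    (hB : M.IsBase (B : Set E)) (hE : M.E = Set.univ)
    (h : ∀ f ∈ X, f ∉ B → ∀ e ∈ B, e ∉ X → ¬ M.Indep ((insert f (B.erase e) : Finset E) : Set E)) :
    rank M X = (B ∩ X).card := by
  have hind : M.Indep ((B ∩ X : Finset E) : Set E) :=
    hB.indep.subset (Finset.coe_subset.2 Finset.inter_subset_left)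
  apply rank_eq_card
  refine hind.isBasis_of_subset_of_subset_closure (Finset.coe_subset.2 Finset.inter_subset_right) ?_
  intro f hfX
  have hfE : f ∈ M.E := by simp [hE]
  by_cases hfB : f ∈ B
  · exact M.mem_closure_of_mem' (by simpa using ⟨hfB, hfX⟩) hfE
  have hfcl : f ∈ M.closure (B : Set E) := by rw [hB.closure_eq]; exact hfE
  -- The fundamental circuit of `f` stays in `X`, since a member outside `X` could be exchanged for
  -- `f`. So `f` is spanned by `B ∩ X`.
  have hC := hB.indep.fundCircuit_isCircuit hfcl (by simpa using hfB)
  have hmem := hC.mem_closure_sdiff_singleton_of_mem (M.mem_fundCircuit f B)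
  refine M.closure_subset_closure ?_ hmem
  rintro x ⟨hx, hxf⟩
  have hxf : x ≠ f := by simpa using hxf
  have hxB : x ∈ B := by simpa [hxf] using M.fundCircuit_subset_insert f B hx
  rw [hB.indep.mem_fundCircuit_iff hfcl (by simpa using hfB)] at hx
  by_contra hxX
  refine h f hfX hfB x hxB (fun hX => hxX (by simpa using ⟨hxB, hX⟩)) ?_
  rwa [Finset.coe_insert, Finset.coe_erase, Set.insert_sdiff_singleton_comm hxf.symm]

/-! ### The sets on the forbidden set face -/

theorem forbiddenSetForm_incidence (M : Matroid E) (lo hi : ℕ) (F I : Finset E) :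
    forbiddenSetForm M lo hi F (incidence I) =
      ((hi : ℝ) - rank M F) * (I ∩ F).card - ((rank M F : ℝ) - lo) * (I \ F).card := by
  simp [forbiddenSetForm, setSum_incidence, Finset.sdiff_eq_inter_compl]

theorem forbiddenSetForm_single_of_mem (M : Matroid E) (lo hi : ℕ) {F : Finset E} {e : E}
    (he : e ∈ F) : forbiddenSetForm M lo hi F (Pi.single e 1) = (hi : ℝ) - rank M F := by
  simp [forbiddenSetForm, setSum_single, he]

theorem forbiddenSetForm_single_of_notMem (M : Matroid E) (lo hi : ℕ) {F : Finset E} {e : E}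
    (he : e ∉ F) : forbiddenSetForm M lo hi F (Pi.single e 1) = -((rank M F : ℝ) - lo) := by
  simp [forbiddenSetForm, setSum_single, he]

/-- The independent sets whose incidence vectors satisfy the forbidden set inequality with
equality. -/
def tightSets (M : Matroid E) (lo hi : ℕ) (F : Finset E) : Set (Finset E) :=
  {I | M.Indep (I : Set E) ∧
    ((I.card = lo ∧ I ⊆ F) ∨ (I.card = hi ∧ (I ∩ F).card = rank M F))}

/-- The slack is a sum of nonnegative terms. With `d = |I \ F|` it is `(hi - r)(d + s) + (r - lo)d`
if `|I| = lo - s`; with `u = r - |I ∩ F|` it is `(hi - lo)u + (r - lo)s` if `|I| = hi + s`. -/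
theorem forbiddenSetForm_incidence_le {M : Matroid E} {lo hi : ℕ} {F I : Finset E}
    (hlo : lo < rank M F) (hhi : rank M F < hi) (hI : M.Indep (I : Set E))
    (hc : I.card ≤ lo ∨ hi ≤ I.card) :
    forbiddenSetForm M lo hi F (incidence I) ≤ lo * ((hi : ℝ) - rank M F) ∧
      (forbiddenSetForm M lo hi F (incidence I) = lo * ((hi : ℝ) - rank M F) ↔
        I ∈ tightSets M lo hi F) := by
  have hsub : (I ∩ F).card ≤ rank M F :=
    card_le_rank (hI.subset (Finset.coe_subset.2 Finset.inter_subset_left))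
      Finset.inter_subset_right
  have hsum : (I ∩ F).card + (I \ F).card = I.card := Finset.card_inter_add_card_sdiff I F
  have htight : I ∈ tightSets M lo hi F ↔ ((I.card = lo ∧ (I \ F).card = 0) ∨
      (I.card = hi ∧ (I ∩ F).card = rank M F)) := by
    simp [tightSets, hI, Finset.sdiff_eq_empty_iff_subset]
  rw [htight, forbiddenSetForm_incidence, ← hsum]
  rw [← hsum] at hc
  generalize (I ∩ F).card = a at *
  generalize (I \ F).card = d at *
  generalize rank M F = r at *
  have h1 : (0 : ℝ) < (hi : ℝ) - r := sub_pos.2 (by exact_mod_cast hhi)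
  have h2 : (0 : ℝ) < (r : ℝ) - lo := sub_pos.2 (by exact_mod_cast hlo)
  rcases hc with hc | hc
  · obtain ⟨s, rfl⟩ := Nat.exists_eq_add_of_le hc
    have key : ((a + d + s : ℕ) : ℝ) * ((hi : ℝ) - r) - (((hi : ℝ) - r) * a -
        ((r : ℝ) - (a + d + s : ℕ)) * d) =
        ((hi : ℝ) - r) * (d + s) + ((r : ℝ) - (a + d + s : ℕ)) * d := by push_cast; ring
    have n1 : 0 ≤ ((hi : ℝ) - r) * (d + s) := by positivity
    have n2 : 0 ≤ ((r : ℝ) - (a + d + s : ℕ)) * d := by positivity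
    refine ⟨by linarith, fun h => Or.inl ?_, ?_⟩
    · have hz : ((hi : ℝ) - r) * (d + s) = 0 := by linarith
      have hds : ((d + s : ℕ) : ℝ) = 0 := by
        push_cast; exact (mul_eq_zero.1 hz).resolve_left h1.ne'
      have : d + s = 0 := by exact_mod_cast hds
      omega
    · rintro (⟨h, hd⟩ | ⟨h, h'⟩)
      · obtain rfl : s = 0 := by omega
        subst hd
        push_cast at key ⊢
        linarith
      · omega
  · obtain ⟨s, hs⟩ := Nat.exists_eq_add_of_le hc
    obtain ⟨u, rfl⟩ := Nat.exists_eq_add_of_le hsub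
    have hd : (d : ℝ) = hi + s - a := by
      have : (a : ℝ) + d = hi + s := by exact_mod_cast hs
      linarith
    have h3 : (0 : ℝ) < (hi : ℝ) - lo := by linarith
    have key : (lo : ℝ) * ((hi : ℝ) - (a + u : ℕ)) - (((hi : ℝ) - (a + u : ℕ)) * a -
        (((a + u : ℕ) : ℝ) - lo) * d) =
        ((hi : ℝ) - lo) * u + (((a + u : ℕ) : ℝ) - lo) * s := by rw [hd]; push_cast; ring
    have n1 : 0 ≤ ((hi : ℝ) - lo) * u := by positivity
    have n2 : 0 ≤ (((a + u : ℕ) : ℝ) - lo) * s := by positivity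
    refine ⟨by linarith, fun h => Or.inr ?_, ?_⟩
    · have hu : ((hi : ℝ) - lo) * u = 0 := by linarith
      have hs0 : (((a + u : ℕ) : ℝ) - lo) * s = 0 := by linarith
      have hu' : u = 0 := by exact_mod_cast (mul_eq_zero.1 hu).resolve_left h3.ne'
      have hs' : s = 0 := by exact_mod_cast (mul_eq_zero.1 hs0).resolve_left h2.ne'
      omega
    · rintro (⟨h, hd⟩ | ⟨h, h'⟩)
      · omega
      · obtain rfl : s = 0 := by omega
        obtain rfl : u = 0 := by omega
        push_cast at key ⊢
        linarith

theorem exists_mem_tightSets {M : Matroid E} (hE : M.E = Set.univ) {hi : ℕ} {F : Finset E}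
    (hhi : rank M F ≤ hi) (hr : hi ≤ rank M Finset.univ) :
    ∃ I : Finset E, M.Indep (I : Set E) ∧ I.card = hi ∧ (I ∩ F).card = rank M F := by
  obtain ⟨I₀, -, hI₀⟩ := exists_isBasis_superset hE (I := ∅) (F := F) (by simp) (by simp)
  obtain ⟨B, -, hB⟩ := exists_isBasis_superset hE (I := ∅) (F := .univ) (by simp) (by simp)
  obtain ⟨J, hIJ, hJ, hJc⟩ := exists_indep_superset_card_eq hI₀.indep hB.indep (n := hi)
    (by rwa [← rank_eq_card hI₀]) (by rwa [← rank_eq_card hB])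
  refine ⟨J, hJ, hJc, le_antisymm ?_ ?_⟩
  · exact card_le_rank (hJ.subset (Finset.coe_subset.2 Finset.inter_subset_left))
      Finset.inter_subset_right
  · rw [rank_eq_card hI₀]
    exact Finset.card_le_card (Finset.subset_inter hIJ (Finset.coe_subset.1 hI₀.subset))

/-! ### Necessity -/

theorem eq_zero_of_smul_forbiddenSetForm {M : Matroid E} {lo hi : ℕ} {F : Finset E}
    (hhi : rank M F < hi) {t : ℝ} {φ : Module.Dual ℝ (E → ℝ)}
    (h : t • forbiddenSetForm M lo hi F = φ) {e : E} (he : e ∈ F)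
    (hφ : φ (Pi.single e 1) = 0) : φ = 0 := by
  have h1 : (0 : ℝ) < (hi : ℝ) - rank M F := sub_pos.2 (by exact_mod_cast hhi)
  rw [← h, LinearMap.smul_apply, forbiddenSetForm_single_of_mem M lo hi he, smul_eq_mul] at hφ
  rw [← h, (mul_eq_zero.1 hφ).resolve_right h1.ne', zero_smul]

/-- A tight set not contained in `F` includes a basis of `F`, which already spans `e`. -/
theorem notMem_of_mem_tightSets {M : Matroid E} (hE : M.E = Set.univ) {lo hi : ℕ}
    {F I : Finset E} (hI : I ∈ tightSets M lo hi F) {e : E}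
    (he : e ∈ M.closure (F : Set E)) (heF : e ∉ F) : e ∉ I := by
  obtain ⟨hI, ⟨-, hIF⟩ | ⟨-, hIF⟩⟩ := hI
  · exact fun h => heF (hIF h)
  intro heI
  have hb := isBasis_of_card_eq_rank hE
    (hI.subset (Finset.coe_subset.2 Finset.inter_subset_left)) Finset.inter_subset_right hIF
  rw [← hb.closure_eq_closure, hb.indep.mem_closure_iff_of_notMem (by simp [heF])] at he
  refine he.not_indep (hI.subset ?_)
  rw [← Finset.coe_insert, Finset.coe_subset]
  exact Finset.insert_subset heI Finset.inter_subset_left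

/-- If the complement of `F` separates and the upper cardinality is the full rank, every set on the
upper part of the face meets each part of the separation in a fixed number of elements. -/
theorem card_inter_eq_of_separation {M : Matroid E} {F A₁ A₂ I : Finset E}
    (hdisj : Disjoint A₁ A₂) (hunion : A₁ ∪ A₂ = Fᶜ)
    (hsep : rank M A₁ᶜ + rank M A₂ᶜ = I.card + rank M F)
    (hI : M.Indep (I : Set E)) (hIF : (I ∩ F).card = rank M F) :
    (I ∩ A₁).card + rank M F = rank M A₂ᶜ ∧ (I ∩ A₂).card + rank M F = rank M A₁ᶜ := by
  have hle : ∀ X : Finset E, (I ∩ X).card ≤ rank M X := fun X =>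
    card_le_rank (hI.subset (Finset.coe_subset.2 Finset.inter_subset_left))
      Finset.inter_subset_right
  have hmem : ∀ x, (x ∈ A₁ ∨ x ∈ A₂ ↔ x ∉ F) := fun x => by
    simpa using Finset.ext_iff.1 hunion x
  have hnot : ∀ x, x ∈ A₁ → x ∉ A₂ := fun x h => Finset.disjoint_left.1 hdisj h
  have e1 : A₁ᶜ = F ∪ A₂ := by
    ext x; have := hmem x; have := hnot x; simp only [Finset.mem_compl, Finset.mem_union]; tauto
  have e2 : A₂ᶜ = F ∪ A₁ := by
    ext x; have := hmem x; have := hnot x; simp only [Finset.mem_compl, Finset.mem_union]; tauto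
  have d1 : Disjoint (I ∩ F) (I ∩ A₁) := Finset.disjoint_left.2 fun x hx hx' =>
    (hmem x).1 (.inl (Finset.mem_inter.1 hx').2) (Finset.mem_inter.1 hx).2
  have d2 : Disjoint (I ∩ F) (I ∩ A₂) := Finset.disjoint_left.2 fun x hx hx' =>
    (hmem x).1 (.inr (Finset.mem_inter.1 hx').2) (Finset.mem_inter.1 hx).2
  -- These two rank bounds add up to the equality `hsep`, so both are attained.
  have c1 := hle A₁ᶜ
  have c2 := hle A₂ᶜ
  rw [e1, Finset.inter_union_distrib_left, Finset.card_union_of_disjoint d2, ← e1] at c1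
  rw [e2, Finset.inter_union_distrib_left, Finset.card_union_of_disjoint d1, ← e2] at c2
  have c3 : (I ∩ F).card + ((I ∩ A₁).card + (I ∩ A₂).card) = I.card := by
    rw [← Finset.card_inter_add_card_sdiff I F, ← Finset.card_union_of_disjoint
      (hdisj.mono Finset.inter_subset_right Finset.inter_subset_right),
      ← Finset.inter_union_distrib_left, hunion, Finset.sdiff_eq_inter_compl]
  omega

/-- On a separable complement there is a form, supported off `F` and nonzero, that vanishes on the
face. -/
theorem exists_form_of_kSeparable {M : Matroid E} (hE : M.E = Set.univ) {lo hi : ℕ} {F : Finset E}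
    (hhi : rank M F < hi) (hr : hi = rank M Finset.univ) (hsep : KSeparable M hi Fᶜ) :
    ∃ φ : Module.Dual ℝ (E → ℝ), φ ≠ 0 ∧ (∀ e ∈ F, φ (Pi.single e 1) = 0) ∧
      ∀ I ∈ tightSets M lo hi F, φ (incidence I) = 0 := by
  obtain ⟨A₁, A₂, ⟨e₁, h₁⟩, ⟨e₂, h₂⟩, hdisj, hunion, hk⟩ := hsep
  have hk' : rank M A₁ᶜ + rank M A₂ᶜ = hi + rank M F := by
    simp only [kRank, compl_compl] at hk
    omega
  obtain ⟨J, hJ, hJc, hJF⟩ := exists_mem_tightSets hE hhi.le hr.le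
  have hJ' := card_inter_eq_of_separation hdisj hunion (by rw [hk', hJc]) hJ hJF
  have hsub₁ : ∀ e ∈ A₁, e ∉ F := fun e he => by
    simpa using (hunion ▸ Finset.mem_union_left _ he : e ∈ Fᶜ)
  have hsub₂ : ∀ e ∈ A₂, e ∉ F := fun e he => by
    simpa using (hunion ▸ Finset.mem_union_right _ he : e ∈ Fᶜ)
  -- The crossed coefficients cancel on tight sets of size `hi`. They are not both zero, as they add
  -- up to `hi - rank M F > 0`.
  refine ⟨((J ∩ A₂).card : ℝ) • setSum A₁ - ((J ∩ A₁).card : ℝ) • setSum A₂, ?_, ?_, ?_⟩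
  · intro h0
    have g1 : (J ∩ A₂).card = 0 := by
      have := LinearMap.congr_fun h0 (Pi.single e₁ 1)
      simpa [setSum_single, h₁, Finset.disjoint_left.1 hdisj h₁] using this
    have g2 : (J ∩ A₁).card = 0 := by
      have := LinearMap.congr_fun h0 (Pi.single e₂ 1)
      simpa [setSum_single, h₂, Finset.disjoint_right.1 hdisj h₂] using this
    omega
  · intro e he
    have n1 : e ∉ A₁ := fun h => hsub₁ e h he
    have n2 : e ∉ A₂ := fun h => hsub₂ e h he
    simp [setSum_single, n1, n2]
  · rintro I ⟨hI, ⟨-, hIF⟩ | ⟨hIc, hIF⟩⟩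
    · have n1 : I ∩ A₁ = ∅ := Finset.disjoint_iff_inter_eq_empty.1
        (Finset.disjoint_left.2 fun x hx hx' => hsub₁ x hx' (hIF hx))
      have n2 : I ∩ A₂ = ∅ := Finset.disjoint_iff_inter_eq_empty.1
        (Finset.disjoint_left.2 fun x hx hx' => hsub₂ x hx' (hIF hx))
      simp [setSum_incidence, n1, n2]
    · have hI' := card_inter_eq_of_separation hdisj hunion (by rw [hk', hIc]) hI hIF
      have g1 : (I ∩ A₁).card = (J ∩ A₁).card := by omega
      have g2 : (I ∩ A₂).card = (J ∩ A₂).card := by omega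
      simp only [LinearMap.sub_apply, LinearMap.smul_apply, setSum_incidence, g1, g2, smul_eq_mul]
      ring

/-! ### Sufficiency -/

/-- If a weight is constant on the bases that meet `F` in a basis of `F`, and `Fᶜ` is inseparable,
then the weight is constant off `F`. -/
theorem weight_eq_of_kInseparable {M : Matroid E} (hE : M.E = Set.univ) {hi : ℕ} {F : Finset E}
    (hhi : rank M F < hi) (hr : hi = rank M Finset.univ) (hins : KInseparable M hi Fᶜ)
    {w : E → ℝ} {γ : ℝ}
    (hw : ∀ I : Finset E, M.Indep (I : Set E) → I.card = hi → (I ∩ F).card = rank M F →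
      ∑ e ∈ I, w e = γ) {e f : E} (he : e ∉ F) (hf : f ∉ F) : w e = w f := by
  by_contra hef
  obtain ⟨B, hB, hBc, hBF⟩ := exists_mem_tightSets hE hhi.le hr.le
  have hbase : M.IsBase (B : Set E) := by
    have := isBasis_of_card_eq_rank hE hB (Finset.subset_univ B) (hBc.trans hr)
    rwa [Finset.coe_univ, ← hE, Matroid.isBasis_ground_iff] at this
  -- If no weight occurs both in `A` and outside `F ∪ A`, then `B` meets `F ∪ A` in a basis. An
  -- exchange bringing in `x ∈ F` would exceed the rank of `F`; one bringing in `x ∈ A` would give a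
  -- tight base of different weight.
  have key : ∀ A : Finset E, (∀ x ∈ A, ∀ y ∉ F, y ∉ A → w x ≠ w y) →
      rank M (F ∪ A) = (B ∩ (F ∪ A)).card := by
    intro A hA
    refine rank_eq_card_inter_of_exchange hbase hE fun x hx hxB y hy hyX hind => ?_
    simp only [Finset.mem_union, not_or] at hx hyX
    have hcard : (insert x (B.erase y)).card = hi := by
      rw [Finset.card_insert_of_notMem (by simp [hxB]), Finset.card_erase_add_one hy, hBc]
    have hBsub : B ∩ F ⊆ B.erase y := fun z hz => by
      rw [Finset.mem_inter] at hz
      exact Finset.mem_erase.2 ⟨fun h => hyX.1 (h ▸ hz.2), hz.1⟩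
    have hle : (insert x (B.erase y) ∩ F).card ≤ rank M F :=
      card_le_rank (hind.subset (Finset.coe_subset.2 Finset.inter_subset_left))
        Finset.inter_subset_right
    by_cases hxF : x ∈ F
    · have : insert x (B ∩ F) ⊆ insert x (B.erase y) ∩ F := by
        refine Finset.insert_subset (by simp [hxF]) (Finset.subset_inter ?_ Finset.inter_subset_right)
        exact hBsub.trans (Finset.subset_insert _ _)
      have := Finset.card_le_card this
      rw [Finset.card_insert_of_notMem (by simp [hxB]), hBF] at this
      omega
    · have hge := Finset.card_le_card (Finset.subset_inter
        (hBsub.trans (Finset.subset_insert x _)) (Finset.inter_subset_right (s₁ := B) (s₂ := F)))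
      have h1 := hw _ hind hcard (le_antisymm hle (hBF ▸ hge))
      have h2 := hw B hB hBc hBF
      rw [Finset.sum_insert (by simp [hxB])] at h1
      rw [← Finset.add_sum_erase B w hy] at h2
      exact hA x (hx.resolve_left hxF) y hyX.1 hyX.2 (by linarith)
  set A₁ : Finset E := {x ∈ Fᶜ | w x = w e} with hA₁
  set A₂ : Finset E := {x ∈ Fᶜ | ¬ w x = w e} with hA₂
  have k1 := key A₁ fun x hx y hyF hy => by
    simp only [hA₁, Finset.mem_filter, Finset.mem_compl, not_and] at hx hy
    exact fun h => hy hyF (h ▸ hx.2)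
  have k2 := key A₂ fun x hx y hyF hy => by
    simp only [hA₂, Finset.mem_filter, Finset.mem_compl, not_and, not_not] at hx hy
    exact fun h => hx.2 (h.trans (hy hyF))
  have hd : Disjoint A₁ A₂ := Finset.disjoint_filter_filter_not _ _ _
  have hu : A₁ ∪ A₂ = Fᶜ := Finset.filter_union_filter_not_eq _ _
  have c1 : A₁ᶜ = F ∪ A₂ := by
    ext x; simp only [hA₁, hA₂, Finset.mem_compl, Finset.mem_union, Finset.mem_filter]; tauto
  have c2 : A₂ᶜ = F ∪ A₁ := by
    ext x; simp only [hA₁, hA₂, Finset.mem_compl, Finset.mem_union, Finset.mem_filter]; tauto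
  refine hins ⟨A₁, A₂, ⟨e, by simp [hA₁, he]⟩, ⟨f, by simp [hA₂, hf, Ne.symm hef]⟩, hd, hu, ?_⟩
  -- By `k1` and `k2` this modular count is the additivity of the `hi`-rank.
  have hcards : (B ∩ (F ∪ A₂)).card + (B ∩ (F ∪ A₁)).card = B.card + (B ∩ F).card := by
    rw [← Finset.card_union_add_card_inter, ← Finset.inter_union_distrib_left,
      ← Finset.inter_inter_distrib_left]
    congr 2
    · rw [← c1, ← c2, ← Finset.compl_inter, Finset.disjoint_iff_inter_eq_empty.1 hd]; simp
    · rw [← c1, ← c2, ← Finset.compl_union, hu, compl_compl]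
  simp only [kRank, compl_compl, c1, c2]
  omega

/-- If a weight is constant on the independent sets of a cardinality below the rank that meet a
flat `F` in a basis of `F`, then the weight is constant off `F`. -/
theorem weight_eq_of_isFlat {M : Matroid E} (hE : M.E = Set.univ) {hi : ℕ} {F : Finset E}
    (hhi : rank M F < hi) (hr : hi < rank M Finset.univ) (hF : M.IsFlat (F : Set E))
    {w : E → ℝ} {γ : ℝ}
    (hw : ∀ I : Finset E, M.Indep (I : Set E) → I.card = hi → (I ∩ F).card = rank M F →
      ∑ e ∈ I, w e = γ) {e f : E} (he : e ∉ F) (hf : f ∉ F) : w e = w f := by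
  obtain ⟨I₀, -, hI₀⟩ := exists_isBasis_superset hE (I := ∅) (F := F) (by simp) (by simp)
  obtain ⟨B, hIB, hB⟩ := exists_isBasis_superset hE hI₀.indep (Finset.subset_univ I₀)
  have hBr := rank_eq_card hB
  have hIr := rank_eq_card hI₀
  have hnl : ∀ x ∉ F, (M.contract (F : Set E)).IsNonloop x := fun x hx => by
    rw [Matroid.contract_isNonloop_iff, hF.closure]
    simpa [hE] using hx
  have hBF : B ∩ F = I₀ := by
    refine (Finset.eq_of_subset_of_card_le (Finset.subset_inter hIB
      (Finset.coe_subset.1 hI₀.subset)) ?_).symm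
    rw [← hIr]
    exact card_le_rank (hB.indep.subset (Finset.coe_subset.2 Finset.inter_subset_left))
      Finset.inter_subset_right
  have hK : (M.contract (F : Set E)).Indep ((B \ F : Finset E) : Set E) := by
    rw [hI₀.contract_indep_iff]
    refine ⟨hB.indep.subset ?_, ?_⟩
    · rw [← Finset.coe_union, Finset.coe_subset]
      exact Finset.union_subset Finset.sdiff_subset hIB
    · rw [Finset.disjoint_coe]
      exact Finset.disjoint_sdiff
  have hKc : (B \ F).card + rank M F = rank M Finset.univ := by
    rw [hBr, hIr, ← hBF, add_comm, Finset.card_inter_add_card_sdiff]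
  -- Independent sets of the contraction by `F` of this size become tight when `I₀` is added.
  -- Elements off the flat are nonloops there, and `hi < r(E)` leaves the room that the lemma needs.
  refine weight_eq_of_sum_eq (k := hi - rank M F) (γ := γ - ∑ x ∈ I₀, w x) (by omega) ?_ hK
    (by omega) (hnl e he) (hnl f hf)
  intro J hJ hJc
  rw [hI₀.contract_indep_iff, Finset.disjoint_coe] at hJ
  have hd : Disjoint J I₀ := (hJ.2.mono_left (Finset.coe_subset.1 hI₀.subset)).symm
  have := hw (J ∪ I₀) (by simpa using hJ.1)
    (by rw [Finset.card_union_of_disjoint hd, hJc]; omega)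
    (by rw [Finset.union_inter_distrib_right, Finset.disjoint_iff_inter_eq_empty.1 hJ.2.symm,
          Finset.empty_union, Finset.inter_eq_left.2 (Finset.coe_subset.1 hI₀.subset), hIr])
  rw [Finset.sum_union hd] at this
  linarith

theorem affDim_tightSets_add_one_eq_card_iff {M : Matroid E} (hE : M.E = Set.univ) [M.Loopless]
    {lo hi : ℕ} {F : Finset E} (hpos : 0 < lo) (hlo : lo < rank M F) (hhi : rank M F < hi)
    (hr : hi ≤ rank M Finset.univ) :
    affDim (incidence '' tightSets M lo hi F) + 1 = Fintype.card E ↔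
      M.IsFlat (F : Set E) ∧ (KInseparable M hi Fᶜ ∨ hi < rank M Finset.univ) := by
  have h1 : (0 : ℝ) < (hi : ℝ) - rank M F := sub_pos.2 (by exact_mod_cast hhi)
  obtain ⟨I₀, -, hI₀⟩ := exists_isBasis_superset hE (I := ∅) (F := F) (by simp) (by simp)
  have hI₀c := rank_eq_card hI₀
  obtain ⟨x₀, hx₀⟩ : I₀.Nonempty := Finset.card_pos.1 (by omega)
  have hx₀F : x₀ ∈ F := Finset.coe_subset.1 hI₀.subset hx₀
  have hne : forbiddenSetForm M lo hi F ≠ 0 := fun h => by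
    have := forbiddenSetForm_single_of_mem M lo hi hx₀F
    rw [h, LinearMap.zero_apply] at this
    linarith
  have htight : ∀ x ∈ incidence '' tightSets M lo hi F,
      forbiddenSetForm M lo hi F x = lo * ((hi : ℝ) - rank M F) := by
    rintro _ ⟨I, hI, rfl⟩
    refine (forbiddenSetForm_incidence_le hlo hhi hI.1 ?_).2.2 hI
    rcases hI.2 with h | h
    · exact .inl h.1.le
    · exact .inr h.1.ge
  rw [affDim_add_one_eq_card_iff hne htight]
  constructor
  · intro h
    constructor
    · by_contra hflat
      have : ¬ M.closure (F : Set E) ⊆ F := fun hsub => by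
        have hcl := hsub.antisymm (M.subset_closure (F : Set E) (by simp [hE]))
        exact hflat (hcl ▸ M.isFlat_closure (F : Set E))
      obtain ⟨e, he, heF⟩ := Set.not_subset.1 this
      have hv : ∀ x ∈ incidence '' tightSets M lo hi F,
          (LinearMap.proj e : (E → ℝ) →ₗ[ℝ] ℝ) x = 0 := by
        rintro _ ⟨I, hI, rfl⟩
        simpa [incidence] using notMem_of_mem_tightSets hE hI he heF
      obtain ⟨t, ht⟩ := h (LinearMap.proj e) fun x hx y hy => (hv x hx).trans (hv y hy).symm
      have hxe : e ≠ x₀ := fun h => heF (h ▸ hx₀F)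
      have := eq_zero_of_smul_forbiddenSetForm hhi ht hx₀F (by simp [hxe])
      simpa using LinearMap.congr_fun this (Pi.single e 1)
    · by_contra hcon
      rw [not_or, KInseparable, not_not] at hcon
      obtain ⟨φ, hφ, hφF, hφI⟩ := exists_form_of_kSeparable (lo := lo) hE hhi
        (le_antisymm hr (not_lt.1 hcon.2)) hcon.1
      have hv : ∀ x ∈ incidence '' tightSets M lo hi F, φ x = 0 := by
        rintro _ ⟨I, hI, rfl⟩
        exact hφI I hI
      obtain ⟨t, ht⟩ := h φ fun x hx y hy => (hv x hx).trans (hv y hy).symm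
      exact hφ (eq_zero_of_smul_forbiddenSetForm hhi ht hx₀F (hφF x₀ hx₀F))
  · rintro ⟨hflat, hsep⟩ φ hφ
    obtain ⟨L, hLI, hLc⟩ := Finset.exists_subset_card_eq (show lo ≤ I₀.card by omega)
    have hLF : L ⊆ F := hLI.trans (Finset.coe_subset.1 hI₀.subset)
    have hL : L ∈ tightSets M lo hi F :=
      ⟨hI₀.indep.subset (Finset.coe_subset.2 hLI), .inl ⟨hLc, hLF⟩⟩
    have hconst : ∀ I ∈ tightSets M lo hi F,
        ∑ e ∈ I, φ (Pi.single e 1) = φ (incidence L) := fun I hI => by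
      rw [← apply_incidence]
      exact hφ _ ⟨I, hI, rfl⟩ _ ⟨L, hL, rfl⟩
    obtain ⟨J, hJ, hJc, hJF⟩ := exists_mem_tightSets hE hhi.le hr
    have hin : ∀ e ∈ F, φ (Pi.single e 1) = φ (Pi.single x₀ 1) := fun e he => by
      refine weight_eq_of_sum_eq (N := M.restrict (F : Set E)) (w := fun e => φ (Pi.single e 1))
        (γ := φ (incidence L)) (K := I₀) hpos (fun I hI hIc => ?_) ?_ (by omega) ?_ ?_
      · rw [Matroid.restrict_indep_iff, Finset.coe_subset] at hI
        exact hconst I ⟨hI.1, .inl ⟨hIc, hI.2⟩⟩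
      · exact Matroid.restrict_indep_iff.2 ⟨hI₀.indep, hI₀.subset⟩
      · exact (Matroid.restrict_isNonloop_iff).2
          ⟨M.isNonloop_of_loopless (by simp [hE]), by simpa using he⟩
      · exact (Matroid.restrict_isNonloop_iff).2
          ⟨M.isNonloop_of_loopless (by simp [hE]), by simpa using hx₀F⟩
    have hJne : (J \ F).Nonempty := Finset.card_pos.1 (by
      have := Finset.card_inter_add_card_sdiff J F
      omega)
    obtain ⟨y₀, hy₀⟩ := hJne
    have hy₀F : y₀ ∉ F := (Finset.mem_sdiff.1 hy₀).2
    have hout : ∀ e ∉ F, φ (Pi.single e 1) = φ (Pi.single y₀ 1) := fun e he => by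
      have hw : ∀ I : Finset E, M.Indep (I : Set E) → I.card = hi → (I ∩ F).card = rank M F →
          ∑ e ∈ I, φ (Pi.single e 1) = φ (incidence L) := fun I hI hIc hIF =>
        hconst I ⟨hI, .inr ⟨hIc, hIF⟩⟩
      rcases lt_or_eq_of_le hr with hlt | heq
      · exact weight_eq_of_isFlat (w := fun e => φ (Pi.single e 1)) hE hhi hlt hflat hw he hy₀F
      · exact weight_eq_of_kInseparable (w := fun e => φ (Pi.single e 1)) hE hhi heq
          (hsep.resolve_right heq.not_lt) hw he hy₀F
    have e1 := hconst L hL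
    have e2 := hconst J ⟨hJ, .inr ⟨hJc, hJF⟩⟩
    rw [Finset.sum_congr rfl fun e he => hin e (hLF he), Finset.sum_const, hLc, nsmul_eq_mul] at e1
    rw [← Finset.sum_inter_add_sum_sdiff J F,
      Finset.sum_congr rfl fun e he => hin e (Finset.mem_inter.1 he).2,
      Finset.sum_congr (s₁ := J \ F) rfl fun e he => hout e (Finset.mem_sdiff.1 he).2,
      Finset.sum_const, Finset.sum_const, hJF, nsmul_eq_mul, nsmul_eq_mul] at e2
    have hd : ((J \ F).card : ℝ) = (hi : ℝ) - rank M F := by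
      have := Finset.card_inter_add_card_sdiff J F
      rw [hJF, hJc] at this
      rw [← this]
      push_cast
      ring
    rw [hd] at e2
    -- With `α` on `F` and `β` off `F`, `e1` and `e2` give `lo·α = r·α + (hi - r)·β`, so `β = -(r -
    -- lo)·α/(hi - r)`.
    refine ⟨φ (Pi.single x₀ 1) / ((hi : ℝ) - rank M F), dual_ext fun e => ?_⟩
    rw [LinearMap.smul_apply, smul_eq_mul]
    by_cases he : e ∈ F
    · rw [forbiddenSetForm_single_of_mem M lo hi he, hin e he, div_mul_cancel₀ _ h1.ne']
    · rw [forbiddenSetForm_single_of_notMem M lo hi he, hout e he, div_mul_eq_mul_div,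
        div_eq_iff h1.ne']
      linarith

/-! ### Dimension of the polytope -/

/-- A linear form taking the same value on all independent sets of two different cardinalities,
one of which lies strictly between zero and the rank, vanishes. -/
theorem form_eq_zero_of_forall_incidence {M : Matroid E} (hE : M.E = Set.univ) [M.Loopless]
    {k k' : ℕ} (hk : 0 < k) (hkr : k < rank M Finset.univ) (hk' : k' ≤ rank M Finset.univ)
    (hne : k ≠ k') {φ : Module.Dual ℝ (E → ℝ)} {β : ℝ}
    (h : ∀ I : Finset E, M.Indep (I : Set E) → I.card = k ∨ I.card = k' → φ (incidence I) = β) :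
    φ = 0 := by
  obtain ⟨B, -, hB⟩ := exists_isBasis_superset hE (I := ∅) (F := .univ) (by simp) (by simp)
  have hBc := rank_eq_card hB
  obtain ⟨x₀, -⟩ : B.Nonempty := Finset.card_pos.1 (by omega)
  have hc : ∀ e, φ (Pi.single e 1) = φ (Pi.single x₀ 1) := fun e =>
    weight_eq_of_sum_eq (w := fun e => φ (Pi.single e 1)) hk
      (fun I hI hIc => (apply_incidence φ I).symm.trans (h I hI (.inl hIc))) hB.indep (by omega)
      (M.isNonloop_of_loopless (by simp [hE])) (M.isNonloop_of_loopless (by simp [hE]))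
  have hval : ∀ n ≤ B.card, n = k ∨ n = k' → (n : ℝ) * φ (Pi.single x₀ 1) = β := fun n hn hn' => by
    obtain ⟨I, hI, hIc⟩ := Finset.exists_subset_card_eq hn
    have := h I (hB.indep.subset (Finset.coe_subset.2 hI)) (hIc ▸ hn')
    rwa [apply_incidence, Finset.sum_congr rfl fun e _ => hc e, Finset.sum_const, hIc,
      nsmul_eq_mul] at this
  have e1 := hval k (by omega) (.inl rfl)
  have e2 := hval k' (by omega) (.inr rfl)
  have hz : ((k : ℝ) - k') * φ (Pi.single x₀ 1) = 0 := by linarith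
  have hx : φ (Pi.single x₀ 1) = 0 :=
    (mul_eq_zero.1 hz).resolve_left (sub_ne_zero.2 (by exact_mod_cast hne))
  exact dual_ext fun e => by rw [hc e, hx, LinearMap.zero_apply]

/-- Since `𝓘` need only contain the sets of the two sizes, this covers the whole polytope as well as
the cone over a single cardinality. -/
theorem affDim_incidence_eq_card {M : Matroid E} (hE : M.E = Set.univ) [M.Loopless]
    {k k' : ℕ} (hk : 0 < k) (hkr : k < rank M Finset.univ) (hk' : k' ≤ rank M Finset.univ)
    (hne : k ≠ k') {𝓘 : Set (Finset E)}
    (h𝓘 : ∀ I : Finset E, M.Indep (I : Set E) → I.card = k ∨ I.card = k' → I ∈ 𝓘) :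
    affDim (incidence '' 𝓘) = Fintype.card E := by
  refine affDim_eq_card fun φ hφ => ?_
  obtain ⟨B, -, hB⟩ := exists_isBasis_superset hE (I := ∅) (F := .univ) (by simp) (by simp)
  obtain ⟨K, hK, hKc⟩ := Finset.exists_subset_card_eq (show k ≤ B.card by
    rw [← rank_eq_card hB]; exact hkr.le)
  have hKi := h𝓘 K (hB.indep.subset (Finset.coe_subset.2 hK)) (.inl hKc)
  exact form_eq_zero_of_forall_incidence hE hk hkr hk' hne (β := φ (incidence K))
    fun I hI hIc => hφ _ ⟨I, h𝓘 I hI hIc, rfl⟩ _ ⟨K, hKi, rfl⟩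

/-! ### Facets as dimension equations for families of sets -/

theorem cardPolytope_eq {m : ℕ} (M : Matroid E) (c : Fin m → ℕ) :
    cardPolytope M c =
      convexHull ℝ (incidence '' {I : Finset E | M.Indep (I : Set E) ∧ ∃ i, I.card = c i}) := by
  rw [cardPolytope]
  congr 1
  ext x
  constructor
  · rintro ⟨I, h1, h2, rfl⟩
    exact ⟨I, ⟨h1, h2⟩, rfl⟩
  · rintro ⟨I, ⟨h1, h2⟩, rfl⟩
    exact ⟨I, h1, h2, rfl⟩

/-- The rank inequality on the independent sets of a fixed cardinality. -/
theorem definesFacet_setSum_iff {M : Matroid E} (hE : M.E = Set.univ) {k : ℕ} {F : Finset E}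
    (hF : rank M F ≤ k) (hk : k ≤ rank M Finset.univ) :
    DefinesFacet (cardPolytope M ![k]) (setSum F) (rank M F) ↔
      affDim (incidence '' {I : Finset E | M.Indep (I : Set E) ∧ I.card = k ∧
        (I ∩ F).card = rank M F}) + 1 =
      affDim (incidence '' {I : Finset E | M.Indep (I : Set E) ∧ I.card = k}) := by
  have hV : {I : Finset E | M.Indep (I : Set E) ∧ ∃ i, I.card = ![k] i} =
      {I : Finset E | M.Indep (I : Set E) ∧ I.card = k} := by simp
  have ht : {v ∈ incidence '' {I : Finset E | M.Indep (I : Set E) ∧ I.card = k} |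
      setSum F v = rank M F} = incidence '' {I : Finset E | M.Indep (I : Set E) ∧ I.card = k ∧
        (I ∩ F).card = rank M F} := by
    ext x
    constructor
    · rintro ⟨⟨I, ⟨h1, h2⟩, rfl⟩, h3⟩
      rw [setSum_incidence] at h3
      exact ⟨I, ⟨h1, h2, by exact_mod_cast h3⟩, rfl⟩
    · rintro ⟨I, ⟨h1, h2, h3⟩, rfl⟩
      exact ⟨⟨I, ⟨h1, h2⟩, rfl⟩, by rw [setSum_incidence, h3]⟩
  rw [cardPolytope_eq, hV, definesFacet_convexHull_iff, ht]
  · rintro _ ⟨I, ⟨hI, -⟩, rfl⟩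
    rw [setSum_incidence]
    exact_mod_cast card_le_rank (hI.subset (Finset.coe_subset.2 Finset.inter_subset_left))
      Finset.inter_subset_right
  · rw [ht]
    obtain ⟨I, hI⟩ := exists_mem_tightSets hE hF hk
    exact ⟨_, I, hI, rfl⟩

theorem definesFacet_forbiddenSetForm_iff {M : Matroid E} (hE : M.E = Set.univ) {m : ℕ}
    {c : Fin m → ℕ} {i j : Fin m} {F : Finset E} (hgap : ∀ q, c q ≤ c i ∨ c j ≤ c q)
    (hlo : c i < rank M F) (hhi : rank M F < c j) (hr : c j ≤ rank M Finset.univ) :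
    DefinesFacet (cardPolytope M c) (forbiddenSetForm M (c i) (c j) F)
        ((c i : ℝ) * ((c j : ℝ) - rank M F)) ↔
      affDim (incidence '' tightSets M (c i) (c j) F) + 1 =
        affDim (incidence '' {I : Finset E | M.Indep (I : Set E) ∧ ∃ q, I.card = c q}) := by
  have hle : ∀ I : Finset E, M.Indep (I : Set E) → (∃ q, I.card = c q) → _ :=
    fun I hI hq => forbiddenSetForm_incidence_le hlo hhi hI
      (hq.elim fun q hq => hq ▸ hgap q)
  have ht : {v ∈ incidence '' {I : Finset E | M.Indep (I : Set E) ∧ ∃ q, I.card = c q} |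
      forbiddenSetForm M (c i) (c j) F v = (c i : ℝ) * ((c j : ℝ) - rank M F)} =
      incidence '' tightSets M (c i) (c j) F := by
    ext x
    constructor
    · rintro ⟨⟨I, ⟨h1, h2⟩, rfl⟩, h3⟩
      exact ⟨I, (hle I h1 h2).2.1 h3, rfl⟩
    · rintro ⟨I, hI, rfl⟩
      have hq : ∃ q, I.card = c q := by
        rcases hI.2 with h | h
        · exact ⟨i, h.1⟩
        · exact ⟨j, h.1⟩
      exact ⟨⟨I, ⟨hI.1, hq⟩, rfl⟩, (hle I hI.1 hq).2.2 hI⟩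
  rw [cardPolytope_eq, definesFacet_convexHull_iff, ht]
  · rintro _ ⟨I, hI, rfl⟩
    exact (hle I hI.1 hI.2).1
  · rw [ht]
    obtain ⟨I, hI, hI'⟩ := exists_mem_tightSets hE hhi.le hr
    exact ⟨_, I, ⟨hI, .inr hI'⟩, rfl⟩

/-- Adding the empty set to a nonempty family of sets of a fixed positive cardinality raises the
dimension by one. -/
theorem affDim_incidence_insert_empty {𝓘 : Set (Finset E)} (hne : 𝓘.Nonempty) {k : ℕ} (hk : k ≠ 0)
    (h : ∀ I ∈ 𝓘, I.card = k) :
    affDim (incidence '' insert ∅ 𝓘) = affDim (incidence '' 𝓘) + 1 := by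
  have h0 : incidence (∅ : Finset E) = 0 := by ext; simp [incidence]
  rw [Set.image_insert_eq, h0]
  refine affDim_insert_zero (hne.image _) (a := setSum Finset.univ) (b := k)
    (by exact_mod_cast hk) ?_
  rintro _ ⟨I, hI, rfl⟩
  rw [setSum_incidence, Finset.inter_univ, h I hI]

end CardMatroid

theorem theoremT {E : Type*} [Fintype E] [DecidableEq E]
    (M : Matroid E) (hE : M.E = Set.univ) (hM : M.Loopless)
    (m : ℕ) (c : Fin m → ℕ) (hc : StrictMono c)
    (hcr : ∀ i, c i ≤ CardMatroid.rank M Finset.univ)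
    (p : ℕ) (hp : p + 1 < m) (F : Finset E)
    (hlo : c ⟨p, by omega⟩ < CardMatroid.rank M F)
    (hhi : CardMatroid.rank M F < c ⟨p + 1, hp⟩) :
    CardMatroid.DefinesFacet (CardMatroid.cardPolytope M c)
        (CardMatroid.forbiddenSetForm M (c ⟨p, by omega⟩) (c ⟨p + 1, hp⟩) F)
        ((c ⟨p, by omega⟩ : ℝ) * ((c ⟨p + 1, hp⟩ : ℝ) - (CardMatroid.rank M F : ℝ))) ↔
      (c ⟨p, by omega⟩ = c ⟨0, by omega⟩ ∧ c ⟨0, by omega⟩ = 0 ∧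
        CardMatroid.DefinesFacet (CardMatroid.cardPolytope M ![c ⟨p + 1, hp⟩])
          (CardMatroid.setSum F) (CardMatroid.rank M F : ℝ)) ∨
      (0 < c ⟨p, by omega⟩ ∧ M.IsFlat (F : Set E) ∧
        (CardMatroid.KInseparable M (c ⟨p + 1, hp⟩) Fᶜ ∨
          c ⟨p + 1, hp⟩ < CardMatroid.rank M Finset.univ)) := by
  have hp' : p < m := by omega
  have hgap : ∀ q, c q ≤ c ⟨p, hp'⟩ ∨ c ⟨p + 1, hp⟩ ≤ c q := fun q => by
    rcases Nat.lt_or_ge p q with h | h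
    · exact .inr (hc.monotone (Fin.mk_le_of_le_val h))
    · exact .inl (hc.monotone (Fin.le_def.2 h))
  have hr := hcr ⟨p + 1, hp⟩
  rw [CardMatroid.definesFacet_forbiddenSetForm_iff hE hgap hlo hhi hr]
  rcases Nat.eq_zero_or_pos (c ⟨p, hp'⟩) with h0 | hpos
  · have hp0 : p = 0 := by
      by_contra hne
      have := hc (show (⟨0, by omega⟩ : Fin m) < ⟨p, hp'⟩ from Fin.mk_lt_mk.2 (by omega))
      omega
    subst hp0
    rw [CardMatroid.definesFacet_setSum_iff hE hhi.le hr]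
    have htight : CardMatroid.tightSets M (c ⟨0, hp'⟩) (c ⟨0 + 1, hp⟩) F =
        insert ∅ {I : Finset E | M.Indep (I : Set E) ∧ I.card = c ⟨0 + 1, hp⟩ ∧
          (I ∩ F).card = CardMatroid.rank M F} := by
      ext I
      simp only [CardMatroid.tightSets, h0, Set.mem_ofPred_eq, Set.mem_insert_iff,
        Finset.card_eq_zero]
      constructor
      · rintro ⟨hI, ⟨h, -⟩ | h⟩
        · exact .inl h
        · exact .inr ⟨hI, h⟩
      · rintro (rfl | ⟨hI, h⟩)
        · simp
        · exact ⟨hI, .inr h⟩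
    -- Further cardinalities add no dimension: if `c_{p+1} < r(E)`, both families are
    -- full-dimensional; otherwise `c_{p+1}` is the largest cardinality and the families coincide.
    have hP : CardMatroid.affDim (CardMatroid.incidence ''
          {I : Finset E | M.Indep (I : Set E) ∧ ∃ q, I.card = c q}) =
        CardMatroid.affDim (CardMatroid.incidence ''
          insert ∅ {I : Finset E | M.Indep (I : Set E) ∧ I.card = c ⟨0 + 1, hp⟩}) := by
      rcases lt_or_eq_of_le hr with hlt | heq
      · rw [CardMatroid.affDim_incidence_eq_card hE (k := c ⟨0 + 1, hp⟩) (k' := 0) (by omega) hlt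
          (Nat.zero_le _) (by omega), CardMatroid.affDim_incidence_eq_card hE
          (k := c ⟨0 + 1, hp⟩) (k' := 0) (by omega) hlt (Nat.zero_le _) (by omega)]
        · rintro I hI (h | h)
          · exact .inr ⟨hI, h⟩
          · exact .inl (Finset.card_eq_zero.1 h)
        · rintro I hI (h | h)
          · exact ⟨hI, _, h⟩
          · exact ⟨hI, _, h.trans h0.symm⟩
      · congr 2
        ext I
        constructor
        · rintro ⟨hI, q, hq⟩
          rcases hgap q with h | h
          · exact .inl (Finset.card_eq_zero.1 (by omega))
          · exact .inr ⟨hI, by have := hcr q; omega⟩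
        · rintro (rfl | ⟨hI, h⟩)
          · exact ⟨by simp, _, by rw [h0]; rfl⟩
          · exact ⟨hI, _, h⟩
    obtain ⟨I, hI⟩ := CardMatroid.exists_mem_tightSets hE hhi.le hr
    have hpos : c ⟨0 + 1, hp⟩ ≠ 0 := by omega
    rw [hP, htight,
      CardMatroid.affDim_incidence_insert_empty (𝓘 := {I : Finset E | M.Indep (I : Set E) ∧
        I.card = c ⟨0 + 1, hp⟩ ∧ (I ∩ F).card = CardMatroid.rank M F})
        ⟨I, hI⟩ hpos fun J hJ => hJ.2.1,
      CardMatroid.affDim_incidence_insert_empty (𝓘 := {I : Finset E | M.Indep (I : Set E) ∧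
        I.card = c ⟨0 + 1, hp⟩}) ⟨I, hI.1, hI.2.1⟩ hpos fun J hJ => hJ.2]
    simp [h0]
  · have h0 : ¬ (c ⟨p, hp'⟩ = c ⟨0, by omega⟩ ∧ c ⟨0, by omega⟩ = 0) := by omega
    -- Full dimension comes from the sizes `c_p` and `c_{p+1}`, since `0 < c_p < r(F) < c_{p+1} ≤
    -- r(E)`.
    rw [CardMatroid.affDim_incidence_eq_card hE hpos (by omega) hr (by omega)
        (𝓘 := {I : Finset E | M.Indep (I : Set E) ∧ ∃ q, I.card = c q}),
      CardMatroid.affDim_tightSets_add_one_eq_card_iff hE hpos hlo hhi hr, ← and_assoc]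
    · simp [h0, hpos]
    · rintro I hI (h | h)
      · exact ⟨hI, _, h⟩
      · exact ⟨hI, _, h⟩
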